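/- For complex $a,q$ with $|a|<1$ and $|q|<1$ let $$u(a,q)=\cfrac{2a}{1-q+\cfrac{a^2(1+q)^2}{1-q^3+\cfrac{a^2q(1+q^2)^2}{1-q^5+\cfrac{a^2q^2(1+q^3)^2}{1-q^7+\cdots}}}}$$ be the value of the continued fraction, i.e. the limit of its convergents in the Riemann sphere $\mathbb C\cup\{\infty\}$. Then this limit exists, $u(a,q)\neq 1$, the series below converges absolutely, and $$4\sum_{n=0}^{\infty}\frac{a^{2n+1}}{(2n+1)(1-q^{2n+1})}=\log\left(-1+\frac{2}{1-u(a,q)}\right),$$ where the argument of the logarithm is read as $-1$ if $u(a,q)=\infty$, and where, for each fixed $q$, $\log$ denotes the unique branch of the logarithm of $-1+\frac{2}{1-u(a,q)}$ that is continuous in $a$ on the disc $|a|<1$ and vanishes at $a=0$. In particular, $\log$ is the principal logarithm whenever the imaginary part of the left-hand side lies in $(-\pi,\pi]$; and for real $a,q\in(-1,1)$ the number $u(a,q)$ is real with $|u(a,q)|<1$ and $\log$ is the ordinary real logarithm. -/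

import Mathlib

open Filter Topology

namespace RamanujanCF

/-- The continued fraction
`2a / (1 - q + a²(1 + q)² / (1 - q³ + a²q(1 + q²)² / (1 - q⁵ + a²q²(1 + q³)² / (1 - q⁷ + ⋯))))`. -/
def cf (a q : ℂ) : GenContFract ℂ where
  h := 0
  s := Stream'.Seq.ofStream fun n : ℕ =>
    { a := match n with
        | 0 => 2 * a
        | m + 1 => a ^ 2 * q ^ m * (1 + q ^ (m + 1)) ^ 2
      b := 1 - q ^ (2 * n + 1) }

/-- The `n`-th convergent `Aₙ / Bₙ` of a continued fraction, as a point of the Riemann sphere: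
it is `∞` when `Bₙ = 0`. -/
noncomputable def convergent (g : GenContFract ℂ) (n : ℕ) : OnePoint ℂ :=
  open Classical in
  if g.dens n = 0 then OnePoint.infty else ((g.convs n : ℂ) : OnePoint ℂ)

/-- The value `u(a, q)` of the continued fraction: the limit of its convergents in the Riemann
sphere. -/
noncomputable def u (a q : ℂ) : OnePoint ℂ :=
  limUnder atTop (convergent (cf a q))

/-- The Möbius map `w ↦ -1 + 2 / (1 - w)` on the Riemann sphere without the point `1`; it sends
`∞` to `-1`. (The value at `w = 1` is a placeholder.) -/
noncomputable def moebius (w : OnePoint ℂ) : ℂ :=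
  w.elim (-1) fun z => -1 + 2 / (1 - z)

/-- The term `a^(2n+1) / ((2n+1)(1 - q^(2n+1)))` of the Lambert-type series. -/
noncomputable def term (a q : ℂ) (n : ℕ) : ℂ :=
  a ^ (2 * n + 1) / ((2 * (n : ℂ) + 1) * (1 - q ^ (2 * n + 1)))

/-- `ℓ` is a branch of `log F` on the open unit disc: it is continuous there, `exp ∘ ℓ = F`, and it
is normalized by `ℓ 0 = 0`. -/
def IsLogBranch (ℓ F : ℂ → ℂ) : Prop :=
  ContinuousOn ℓ (Metric.ball 0 1) ∧ ℓ 0 = 0 ∧ ∀ a ∈ Metric.ball (0 : ℂ) 1, Complex.exp (ℓ a) = F a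

end RamanujanCF

/-!
Put `S = ∑ₙ term a q n`. The `q`-binomial series `ψ(a) = ∑ₖ (-1; q)_k / (q; q)_k aᵏ` and
`exp (2 S)` are continuous at `a = 0` with value `1` there, and both satisfy
`F(a) = (1 + a) / (1 - a) * F(q a)`; iterating this equation shows `ψ(a) = exp (2 S)`. As `S` is
odd in `a`, the even part of `ψ` is `cosh (2 S)` and its odd part is `sinh (2 S)`.

These two parts are `T₀` and `2 a T₁` for an explicit sequence `T` which converges and satisfies
the backward recurrence of the continued fraction. Its bilinear pairing with the numerators `A` or
the denominators `B` of the convergents is constant, so that in the limit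
`lim A * lim T = sinh (2 S)` and `lim B * lim T = cosh (2 S)`. Hence `u = tanh (2 S)`, with value
`∞` where `cosh (2 S) = 0`, and the Möbius map `w ↦ -1 + 2 / (1 - w) = (1 + w) / (1 - w)` takes
`tanh (2 S)` to `exp (4 S)`.
-/

namespace RamanujanCF

section PowerSeries

variable {𝕜 : Type*} [NormedField 𝕜] {c : ℕ → 𝕜} {C : ℝ} {e : ℕ → ℕ}

lemma norm_mul_pow_le (hc : ∀ k, ‖c k‖ ≤ C) (he : ∀ k, k ≤ e k) {z : 𝕜} {ρ : ℝ} (hz : ‖z‖ ≤ ρ)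
    (hρ : ρ ≤ 1) (k : ℕ) : ‖c k * z ^ e k‖ ≤ C * ρ ^ k := by
  have hρ0 : 0 ≤ ρ := (norm_nonneg z).trans hz
  have hC : 0 ≤ C := (norm_nonneg _).trans (hc k)
  calc ‖c k * z ^ e k‖ = ‖c k‖ * ‖z‖ ^ e k := by rw [norm_mul, norm_pow]
    _ ≤ C * ρ ^ e k := by gcongr; exact hc k
    _ ≤ C * ρ ^ k := by gcongr ?_ * ?_; exact pow_le_pow_of_le_one hρ0 hρ (he k)

lemma norm_tsum_mul_pow_le (hc : ∀ k, ‖c k‖ ≤ C) (he : ∀ k, k ≤ e k) {z : 𝕜} (hz : ‖z‖ < 1) :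
    ‖∑' k, c k * z ^ e k‖ ≤ C * (1 - ‖z‖)⁻¹ :=
  tsum_of_norm_bounded ((hasSum_geometric_of_lt_one (norm_nonneg z) hz).mul_left C)
    (norm_mul_pow_le hc he le_rfl hz.le)

variable [CompleteSpace 𝕜]

lemma summable_mul_pow (hc : ∀ k, ‖c k‖ ≤ C) (he : ∀ k, k ≤ e k) {z : 𝕜} (hz : ‖z‖ < 1) :
    Summable fun k => c k * z ^ e k :=
  .of_norm_bounded ((summable_geometric_of_lt_one (norm_nonneg z) hz).mul_left C)
    (norm_mul_pow_le hc he le_rfl hz.le)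

lemma continuousOn_tsum_mul_pow (hc : ∀ k, ‖c k‖ ≤ C) (he : ∀ k, k ≤ e k) :
    ContinuousOn (fun z => ∑' k, c k * z ^ e k) (Metric.ball 0 1) := by
  intro z hz
  obtain ⟨ρ, hzρ, hρ⟩ := exists_between (mem_ball_zero_iff.mp hz)
  have hcont : ContinuousOn (fun z => ∑' k, c k * z ^ e k) (Metric.closedBall 0 ρ) :=
    continuousOn_tsum (fun k => by fun_prop)
      ((summable_geometric_of_lt_one ((norm_nonneg z).trans hzρ.le) hρ).mul_left C)
      fun k w hw => norm_mul_pow_le hc he (mem_closedBall_zero_iff.mp hw) hρ.le k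
  refine (hcont.continuousAt ?_).continuousWithinAt
  exact mem_of_superset (Metric.isOpen_ball.mem_nhds (mem_ball_zero_iff.mpr hzρ))
    Metric.ball_subset_closedBall

end PowerSeries

section Dilation

variable {𝕜 M : Type*} [NormedField 𝕜] [CommMonoid M] {f g h : 𝕜 → M} {q z : 𝕜}

lemma norm_pow_mul_lt_one (hq : ‖q‖ < 1) (hz : ‖z‖ < 1) (n : ℕ) : ‖q ^ n * z‖ < 1 := by
  rw [norm_mul, norm_pow]
  exact (mul_le_of_le_one_left (norm_nonneg z) (pow_le_one₀ (norm_nonneg q) hq.le)).trans_lt hz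

lemma eq_prod_mul_of_dilation (hq : ‖q‖ < 1) (hf : ∀ w, ‖w‖ < 1 → f w = h w * f (q * w))
    (hz : ‖z‖ < 1) (n : ℕ) :
    f z = (∏ i ∈ Finset.range n, h (q ^ i * z)) * f (q ^ n * z) := by
  induction n with
  | zero => simp
  | succ n ih =>
    rw [ih, hf _ (norm_pow_mul_lt_one hq hz n), Finset.prod_range_succ, pow_succ', mul_assoc q,
      mul_assoc]

lemma mul_apply_zero_eq_of_dilation [TopologicalSpace M] [ContinuousMul M] [T2Space M]
    (hq : ‖q‖ < 1) (hf : ∀ w, ‖w‖ < 1 → f w = h w * f (q * w))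
    (hg : ∀ w, ‖w‖ < 1 → g w = h w * g (q * w)) (hf0 : ContinuousAt f 0)
    (hg0 : ContinuousAt g 0) (hz : ‖z‖ < 1) : f z * g 0 = g z * f 0 := by
  have hqz : Tendsto (fun n : ℕ => q ^ n * z) atTop (𝓝 0) := by
    simpa only [zero_mul] using (tendsto_pow_atTop_nhds_zero_of_norm_lt_one hq).mul_const z
  have hfg (n : ℕ) : f z * g (q ^ n * z) = g z * f (q ^ n * z) := by
    rw [eq_prod_mul_of_dilation hq hf hz n, eq_prod_mul_of_dilation hq hg hz n, mul_right_comm]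
  refine tendsto_nhds_unique ((hg0.tendsto.comp hqz).const_mul (f z)) ?_
  exact ((hf0.tendsto.comp hqz).const_mul (g z)).congr fun n => (hfg n).symm

end Dilation

section QPochhammer

/-- The finite `q`-Pochhammer symbol `(c; q)_n = (1 - c)(1 - cq)⋯(1 - cq^(n-1))`, the building
block of the `q`-series below. -/
def qPochhammer {R : Type*} [CommRing R] (c q : R) (n : ℕ) : R :=
  ∏ i ∈ Finset.range n, (1 - c * q ^ i)

variable {R : Type*} [CommRing R] (c q : R)

lemma qPochhammer_zero : qPochhammer c q 0 = 1 :=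
  Finset.prod_range_zero _

lemma qPochhammer_succ (n : ℕ) :
    qPochhammer c q (n + 1) = qPochhammer c q n * (1 - c * q ^ n) :=
  Finset.prod_range_succ _ n

lemma qPochhammer_succ' (n : ℕ) :
    qPochhammer c q (n + 1) = (1 - c) * qPochhammer (c * q) q n := by
  simp only [qPochhammer, Finset.prod_range_succ', pow_succ', ← mul_assoc, pow_zero, mul_one,
    mul_comm]

lemma qPochhammer_two_mul (n : ℕ) :
    qPochhammer c q (2 * n) = qPochhammer c (q ^ 2) n * qPochhammer (c * q) (q ^ 2) n := by
  induction n with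
  | zero => simp only [mul_zero, qPochhammer_zero, mul_one]
  | succ n ih =>
    rw [Nat.mul_succ, qPochhammer_succ, qPochhammer_succ, ih, qPochhammer_succ, qPochhammer_succ]
    ring

end QPochhammer

section NormedQPochhammer

variable {𝕜 : Type*} [NormedField 𝕜] {c q : 𝕜}

lemma norm_sq_lt_one (hq : ‖q‖ < 1) : ‖q ^ 2‖ < 1 :=
  norm_pow q 2 ▸ pow_lt_one₀ (norm_nonneg q) hq two_ne_zero

lemma one_sub_ne_zero_of_norm_lt_one (hc : ‖c‖ < 1) : 1 - c ≠ 0 := by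
  rintro h
  simp [← sub_eq_zero.mp h] at hc

lemma one_sub_pow_ne_zero (hq : ‖q‖ < 1) {n : ℕ} (hn : n ≠ 0) : 1 - q ^ n ≠ 0 :=
  one_sub_ne_zero_of_norm_lt_one (norm_pow q n ▸ pow_lt_one₀ (norm_nonneg q) hq hn)

lemma one_sub_mul_pow_ne_zero (hc : ‖c‖ < 1) (hq : ‖q‖ < 1) (n : ℕ) : 1 - c * q ^ n ≠ 0 :=
  one_sub_ne_zero_of_norm_lt_one (mul_comm c _ ▸ norm_pow_mul_lt_one hq hc n)

lemma qPochhammer_ne_zero (hc : ‖c‖ < 1) (hq : ‖q‖ < 1) (n : ℕ) : qPochhammer c q n ≠ 0 :=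
  Finset.prod_ne_zero_iff.mpr fun i _ => one_sub_mul_pow_ne_zero hc hq i

lemma hasSum_norm_neg_mul_pow (hq : ‖q‖ < 1) :
    HasSum (fun i : ℕ => ‖-(c * q ^ i)‖) (‖c‖ * (1 - ‖q‖)⁻¹) := by
  simpa only [norm_neg, norm_mul, norm_pow] using
    (hasSum_geometric_of_lt_one (norm_nonneg q) hq).mul_left ‖c‖

lemma norm_qPochhammer_le (hq : ‖q‖ < 1) (n : ℕ) :
    ‖qPochhammer c q n‖ ≤ Real.exp (‖c‖ * (1 - ‖q‖)⁻¹) := by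
  have hsum := sum_le_hasSum (Finset.range n) (fun i _ => norm_nonneg _)
    (hasSum_norm_neg_mul_pow (c := c) hq)
  have hprod := (Finset.range n).norm_prod_one_add_sub_one_le fun i => -(c * q ^ i)
  simp only [← sub_eq_add_neg] at hprod
  have htri := norm_le_norm_sub_add (qPochhammer c q n) 1
  rw [norm_one] at htri
  have hexp := Real.exp_le_exp.mpr hsum
  rw [qPochhammer] at *
  linarith

lemma exists_norm_inv_qPochhammer_le [CompleteSpace 𝕜] (hc : ‖c‖ < 1) (hq : ‖q‖ < 1) :
    ∃ C, ∀ n, ‖(qPochhammer c q n)⁻¹‖ ≤ C := by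
  have hsum := (hasSum_norm_neg_mul_pow (c := c) hq).summable
  have hlim : Tendsto (qPochhammer c q) atTop (𝓝 (∏' i, (1 + -(c * q ^ i)))) := by
    refine (multipliable_one_add_of_summable hsum).hasProd.tendsto_prod_nat.congr fun n => ?_
    simp only [qPochhammer, sub_eq_add_neg]
  have hne : ∏' i, (1 + -(c * q ^ i)) ≠ 0 := tprod_one_add_ne_zero_of_summable
    (fun i => by simpa only [← sub_eq_add_neg] using one_sub_mul_pow_ne_zero hc hq i) hsum
  obtain ⟨C, hC⟩ := (Metric.isBounded_range_of_tendsto _ (hlim.inv₀ hne)).exists_norm_le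
  exact ⟨C, fun n => hC _ ⟨n, rfl⟩⟩

end NormedQPochhammer

section QBinomialSeries

variable {𝕜 : Type*} [NormedField 𝕜] {c q z : 𝕜}

/-- The coefficient `(c; q)_k / (q; q)_k` of the `q`-binomial series. -/
noncomputable def qBinomCoeff (c q : 𝕜) (k : ℕ) : 𝕜 :=
  qPochhammer c q k / qPochhammer q q k

/-- The `q`-binomial series `∑ₖ (c; q)_k / (q; q)_k zᵏ`, whose even and odd parts at `c = -1` are
the initial values of the continued fraction's `tail`. -/
noncomputable def qBinomSeries (c q z : 𝕜) : 𝕜 :=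
  ∑' k, qBinomCoeff c q k * z ^ k

lemma qBinomCoeff_succ_mul (c : 𝕜) (hq : ‖q‖ < 1) (k : ℕ) :
    qBinomCoeff c q (k + 1) * (1 - q ^ (k + 1)) = qBinomCoeff c q k * (1 - c * q ^ k) := by
  have hk := one_sub_mul_pow_ne_zero hq hq k
  rw [qBinomCoeff, qBinomCoeff, qPochhammer_succ, qPochhammer_succ, pow_succ', div_mul_eq_mul_div,
    mul_div_mul_right _ _ hk, div_mul_eq_mul_div]

lemma qBinomSeries_zero (c q : 𝕜) : qBinomSeries c q 0 = 1 := by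
  rw [qBinomSeries, tsum_eq_single 0 fun k hk => by rw [zero_pow hk, mul_zero], qBinomCoeff,
    qPochhammer_zero, qPochhammer_zero, div_one, pow_zero, mul_one]

variable [CompleteSpace 𝕜]

lemma exists_norm_qBinomCoeff_le (c : 𝕜) (hq : ‖q‖ < 1) :
    ∃ C, ∀ k, ‖qBinomCoeff c q k‖ ≤ C := by
  obtain ⟨C, hC⟩ := exists_norm_inv_qPochhammer_le hq hq
  refine ⟨Real.exp (‖c‖ * (1 - ‖q‖)⁻¹) * C, fun k => ?_⟩
  rw [qBinomCoeff, div_eq_mul_inv, norm_mul]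
  gcongr
  exacts [norm_qPochhammer_le hq k, hC k]

lemma summable_qBinomSeries (c : 𝕜) (hq : ‖q‖ < 1) (hz : ‖z‖ < 1) :
    Summable fun k => qBinomCoeff c q k * z ^ k := by
  obtain ⟨C, hC⟩ := exists_norm_qBinomCoeff_le c hq
  exact summable_mul_pow hC (fun _ => le_rfl) hz

lemma continuousAt_qBinomSeries_zero (c : 𝕜) (hq : ‖q‖ < 1) :
    ContinuousAt (qBinomSeries c q) 0 := by
  obtain ⟨C, hC⟩ := exists_norm_qBinomCoeff_le c hq
  exact (continuousOn_tsum_mul_pow hC fun _ => le_rfl).continuousAt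
    (Metric.ball_mem_nhds 0 one_pos)

lemma qBinomSeries_dilation (c : 𝕜) (hq : ‖q‖ < 1) (hz : ‖z‖ < 1) :
    qBinomSeries c q z = (1 - c * z) / (1 - z) * qBinomSeries c q (q * z) := by
  have hqz : ‖q * z‖ < 1 := by simpa only [pow_one] using norm_pow_mul_lt_one hq hz 1
  have hs := summable_qBinomSeries c hq hz
  have hs' := summable_qBinomSeries c hq hqz
  have hdiff : qBinomSeries c q z - qBinomSeries c q (q * z) =
      z * qBinomSeries c q z - c * z * qBinomSeries c q (q * z) := by
    unfold qBinomSeries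
    rw [← tsum_mul_left, ← tsum_mul_left, ← hs.tsum_sub hs',
      ← (hs.mul_left z).tsum_sub (hs'.mul_left (c * z)), (hs.sub hs').tsum_eq_zero_add]
    simp only [pow_zero, sub_self, zero_add]
    refine tsum_congr fun k => ?_
    linear_combination z ^ (k + 1) * qBinomCoeff_succ_mul c hq k
  rw [div_mul_eq_mul_div, eq_div_iff (one_sub_ne_zero_of_norm_lt_one hz)]
  linear_combination hdiff

end QBinomialSeries

section Recurrence

/-- Adjointness: `X` runs forwards and `T` backwards through the same recurrence. -/
lemma pairing_eq_of_recurrence {R : Type*} [CommSemiring R] {b c X T : ℕ → R}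
    (hX : ∀ n, X (n + 2) = b (n + 1) * X (n + 1) + c n * X n)
    (hT : ∀ n, T n = b n * T (n + 1) + c n * T (n + 2)) (n : ℕ) :
    X (n + 1) * T (n + 1) + c n * X n * T (n + 2) = X 1 * T 1 + c 0 * X 0 * T 2 := by
  induction n with
  | zero => rfl
  | succ n ih => rw [← ih, hX, hT (n + 1)]; ring

lemma mul_eq_of_recurrence_of_tendsto {R : Type*} [CommSemiring R] [TopologicalSpace R]
    [IsTopologicalSemiring R] [T2Space R] {b c X T : ℕ → R} {x t : R}
    (hX : ∀ n, X (n + 2) = b (n + 1) * X (n + 1) + c n * X n)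
    (hT : ∀ n, T n = b n * T (n + 1) + c n * T (n + 2)) (hc : Tendsto c atTop (𝓝 0))
    (hXx : Tendsto X atTop (𝓝 x)) (hTt : Tendsto T atTop (𝓝 t)) :
    x * t = X 1 * T 1 + c 0 * X 0 * T 2 := by
  have hlim := ((hXx.comp (tendsto_add_atTop_nat 1)).mul (hTt.comp (tendsto_add_atTop_nat 1))).add
    ((hc.mul hXx).mul (hTt.comp (tendsto_add_atTop_nat 2)))
  rw [zero_mul, zero_mul, add_zero] at hlim
  refine tendsto_nhds_unique hlim (tendsto_const_nhds.congr fun n => ?_)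
  exact (pairing_eq_of_recurrence hX hT n).symm

lemma exists_norm_le_of_norm_sub_le_mul_max {E : Type*} [SeminormedAddCommGroup E] {X : ℕ → E}
    {α : ℕ → ℝ} (hα : Summable α) (hα0 : ∀ n, 0 ≤ α n)
    (hX : ∀ n, ‖X (n + 2) - X (n + 1)‖ ≤ α n * max ‖X n‖ ‖X (n + 1)‖) :
    ∃ C, ∀ n, max ‖X n‖ ‖X (n + 1)‖ ≤ C := by
  refine ⟨max ‖X 0‖ ‖X 1‖ * Real.exp (∑' i, α i), fun n => ?_⟩
  have hstep (n : ℕ) : max ‖X (n + 1)‖ ‖X (n + 2)‖ ≤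
      (1 + α n) * max ‖X n‖ ‖X (n + 1)‖ + 0 := by
    have htri := norm_le_norm_sub_add (X (n + 2)) (X (n + 1))
    have hmax := le_max_right ‖X n‖ ‖X (n + 1)‖
    have hnonneg := mul_nonneg (hα0 n) ((norm_nonneg _).trans hmax)
    rw [max_le_iff]
    constructor <;> linarith [hX n]
  have hgronwall := discrete_gronwall (u := fun n => max ‖X n‖ ‖X (n + 1)‖) (b := fun _ => 0)
    (by positivity) (fun n _ => hstep n) (fun n _ => hα0 n) (fun _ _ => le_rfl) n.zero_le
  rw [Finset.sum_const_zero, add_zero] at hgronwall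
  refine hgronwall.trans ?_
  gcongr
  exact hα.sum_le_tsum _ fun i _ => hα0 i

lemma exists_tendsto_of_norm_sub_le_mul_max {E : Type*} [SeminormedAddCommGroup E]
    [CompleteSpace E] {X : ℕ → E} {α : ℕ → ℝ} (hα : Summable α) (hα0 : ∀ n, 0 ≤ α n)
    (hX : ∀ n, ‖X (n + 2) - X (n + 1)‖ ≤ α n * max ‖X n‖ ‖X (n + 1)‖) :
    ∃ x, Tendsto X atTop (𝓝 x) := by
  obtain ⟨C, hC⟩ := exists_norm_le_of_norm_sub_le_mul_max hα hα0 hX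
  have hcauchy : CauchySeq fun n => X (n + 1) :=
    cauchySeq_of_dist_le_of_summable (fun n => α n * C) (fun n => by
      rw [dist_comm, dist_eq_norm]
      exact (hX n).trans (mul_le_mul_of_nonneg_left (hC n) (hα0 n))) (hα.mul_right C)
  obtain ⟨x, hx⟩ := cauchySeq_tendsto_of_complete hcauchy
  exact ⟨x, (tendsto_add_atTop_iff_nat 1).mp hx⟩

lemma exists_tendsto_of_recurrence {𝕜 : Type*} [NormedField 𝕜] [CompleteSpace 𝕜]
    {b c X : ℕ → 𝕜} (hb : Summable fun n => ‖b n - 1‖) (hc : Summable fun n => ‖c n‖)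
    (hX : ∀ n, X (n + 2) = b (n + 1) * X (n + 1) + c n * X n) : ∃ x, Tendsto X atTop (𝓝 x) := by
  refine exists_tendsto_of_norm_sub_le_mul_max (α := fun n => ‖b (n + 1) - 1‖ + ‖c n‖)
    (((summable_nat_add_iff 1).mpr hb).add hc) (fun n => by positivity) fun n => ?_
  calc ‖X (n + 2) - X (n + 1)‖ = ‖(b (n + 1) - 1) * X (n + 1) + c n * X n‖ := by
        rw [hX]
        ring_nf
    _ ≤ ‖b (n + 1) - 1‖ * max ‖X n‖ ‖X (n + 1)‖ + ‖c n‖ * max ‖X n‖ ‖X (n + 1)‖ := by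
        refine norm_add_le_of_le ?_ ?_ <;> rw [norm_mul] <;> gcongr
        exacts [le_max_right _ _, le_max_left _ _]
    _ = (‖b (n + 1) - 1‖ + ‖c n‖) * max ‖X n‖ ‖X (n + 1)‖ := (add_mul _ _ _).symm

end Recurrence

section Tail

variable {𝕜 : Type*} [NormedField 𝕜] {a q : 𝕜}

/-- The partial numerators of the continued fraction `cf`, from the second one on. -/
def partNum (a q : 𝕜) (n : ℕ) : 𝕜 :=
  a ^ 2 * q ^ n * (1 + q ^ (n + 1)) ^ 2

/-- The partial denominators of the continued fraction `cf`. -/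
def partDen (q : 𝕜) (n : ℕ) : 𝕜 :=
  1 - q ^ (2 * n + 1)

/-- The coefficient `(-qⁿ; q)_{2k} / ((q²; q²)_k (q; q²)_{n+k})` of `a^(2k)` in `tail a q n`. -/
noncomputable def tailCoeff (q : 𝕜) (n k : ℕ) : 𝕜 :=
  qPochhammer (-q ^ n) q (2 * k) / (qPochhammer (q ^ 2) (q ^ 2) k * qPochhammer q (q ^ 2) (n + k))

/-- A bounded solution `Tₙ` of the backward recurrence of the continued fraction `cf`: the tail
beginning with the `n`-th partial denominator is `Tₙ / Tₙ₊₁`. -/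
noncomputable def tail (a q : 𝕜) (n : ℕ) : 𝕜 :=
  ∑' k, tailCoeff q n k * a ^ (2 * k)

lemma summable_norm_partNum (a : 𝕜) (hq : ‖q‖ < 1) : Summable fun n => ‖partNum a q n‖ := by
  refine .of_nonneg_of_le (fun n => norm_nonneg _) (fun n => ?_)
    ((summable_geometric_of_lt_one (norm_nonneg q) hq).mul_left (‖a‖ ^ 2 * 2 ^ 2))
  have hfactor : ‖1 + q ^ (n + 1)‖ ≤ 2 := by
    have htri := norm_add_le 1 (q ^ (n + 1))
    have hpow := pow_le_one₀ (norm_nonneg q) hq.le (n := n + 1)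
    rw [norm_one, norm_pow] at htri
    linarith
  rw [partNum, norm_mul, norm_mul, norm_pow, norm_pow, norm_pow, mul_right_comm]
  gcongr

lemma summable_norm_partDen_sub_one (hq : ‖q‖ < 1) : Summable fun n => ‖partDen q n - 1‖ := by
  refine .of_nonneg_of_le (fun n => norm_nonneg _) (fun n => ?_)
    (summable_geometric_of_lt_one (norm_nonneg q) hq)
  rw [partDen, sub_sub_cancel_left, norm_neg, norm_pow]
  exact pow_le_pow_of_le_one (norm_nonneg q) hq.le (by lia)

lemma tailCoeff_zero (hq : ‖q‖ < 1) (n : ℕ) :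
    tailCoeff q n 0 = partDen q n * tailCoeff q (n + 1) 0 := by
  have hn := one_sub_mul_pow_ne_zero hq (norm_sq_lt_one hq) n
  have hpow : q ^ (2 * n + 1) = q * (q ^ 2) ^ n := by rw [pow_succ', pow_mul]
  simp only [tailCoeff, partDen, mul_zero, qPochhammer_zero, add_zero, qPochhammer_succ, one_mul,
    hpow, mul_one_div]
  rw [div_mul_cancel_right₀ hn, one_div]

lemma tailCoeff_succ (hq : ‖q‖ < 1) (n k : ℕ) :
    tailCoeff q n (k + 1) = partDen q n * tailCoeff q (n + 1) (k + 1) +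
      q ^ n * (1 + q ^ (n + 1)) ^ 2 * tailCoeff q (n + 2) k := by
  have hq2 := norm_sq_lt_one hq
  have hnum : qPochhammer (-q ^ n) q (2 * (k + 1)) =
      (1 + q ^ n) * (1 + q ^ (n + 1)) * qPochhammer (-q ^ (n + 2)) q (2 * k) := by
    rw [Nat.mul_succ, qPochhammer_succ', qPochhammer_succ']
    ring_nf
  have hnum' : qPochhammer (-q ^ (n + 1)) q (2 * (k + 1)) = (1 + q ^ (n + 1)) *
      qPochhammer (-q ^ (n + 2)) q (2 * k) * (1 + q ^ (n + 2) * q ^ (2 * k)) := by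
    rw [Nat.mul_succ, qPochhammer_succ', qPochhammer_succ]
    ring_nf
  have hk := one_sub_mul_pow_ne_zero hq2 hq2 k
  have hn := one_sub_mul_pow_ne_zero hq hq2 (n + k + 1)
  have hPk := qPochhammer_ne_zero hq2 hq2 k
  have hPn := qPochhammer_ne_zero hq hq2 (n + k + 1)
  simp only [tailCoeff, partDen]
  rw [hnum, hnum', show n + 1 + (k + 1) = n + k + 1 + 1 by ring,
    show n + 2 + k = n + k + 1 + 1 by ring, ← add_assoc n k 1,
    qPochhammer_succ (q ^ 2), qPochhammer_succ q (q ^ 2) (n + k + 1)]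
  field_simp
  ring

lemma qBinomCoeff_neg_one_even (q : 𝕜) (k : ℕ) :
    qBinomCoeff (-1) q (2 * k) = tailCoeff q 0 k := by
  rw [qBinomCoeff, tailCoeff, qPochhammer_two_mul q, ← sq, pow_zero, zero_add,
    mul_comm (qPochhammer q (q ^ 2) k)]

lemma qBinomCoeff_neg_one_odd (q : 𝕜) (k : ℕ) :
    qBinomCoeff (-1) q (2 * k + 1) = 2 * tailCoeff q 1 k := by
  rw [qBinomCoeff, tailCoeff, qPochhammer_succ' (-1), qPochhammer_succ, qPochhammer_two_mul q,
    add_comm 1 k, qPochhammer_succ q (q ^ 2)]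
  ring_nf

lemma tail_neg (a q : 𝕜) (n : ℕ) : tail (-a) q n = tail a q n := by
  simp only [tail, pow_mul, neg_sq]

variable [CompleteSpace 𝕜]

lemma exists_norm_tailCoeff_le (hq : ‖q‖ < 1) : ∃ C, ∀ n k, ‖tailCoeff q n k‖ ≤ C := by
  have hq2 := norm_sq_lt_one hq
  obtain ⟨C₁, hC₁⟩ := exists_norm_inv_qPochhammer_le hq2 hq2
  obtain ⟨C₂, hC₂⟩ := exists_norm_inv_qPochhammer_le hq hq2
  have hC₁0 : 0 ≤ C₁ := (norm_nonneg _).trans (hC₁ 0)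
  refine ⟨Real.exp (1 * (1 - ‖q‖)⁻¹) * (C₁ * C₂), fun n k => ?_⟩
  have hqn : ‖-q ^ n‖ ≤ 1 := by
    rw [norm_neg, norm_pow]
    exact pow_le_one₀ (norm_nonneg q) hq.le
  have hnum := norm_qPochhammer_le (c := -q ^ n) hq (2 * k)
  rw [tailCoeff, div_eq_mul_inv, norm_mul, mul_inv, norm_mul]
  have : 0 ≤ (1 - ‖q‖)⁻¹ := inv_nonneg.mpr (sub_nonneg.mpr hq.le)
  gcongr
  · exact hnum.trans (by gcongr)
  · exact hC₁ k
  · exact hC₂ (n + k)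

lemma summable_tail (ha : ‖a‖ < 1) (hq : ‖q‖ < 1) (n : ℕ) :
    Summable fun k => tailCoeff q n k * a ^ (2 * k) := by
  obtain ⟨C, hC⟩ := exists_norm_tailCoeff_le hq
  exact summable_mul_pow (hC n) (fun k => Nat.le_mul_of_pos_left k two_pos) ha

lemma exists_norm_tail_le (ha : ‖a‖ < 1) (hq : ‖q‖ < 1) : ∃ C, ∀ n, ‖tail a q n‖ ≤ C := by
  obtain ⟨C, hC⟩ := exists_norm_tailCoeff_le hq
  exact ⟨_, fun n => norm_tsum_mul_pow_le (hC n) (fun k => Nat.le_mul_of_pos_left k two_pos) ha⟩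

lemma tail_recurrence (ha : ‖a‖ < 1) (hq : ‖q‖ < 1) (n : ℕ) :
    tail a q n = partDen q n * tail a q (n + 1) + partNum a q n * tail a q (n + 2) := by
  have hs₁ := (summable_tail ha hq (n + 1)).mul_left (partDen q n)
  have hs₂ := (summable_tail ha hq (n + 2)).mul_left (partNum a q n)
  unfold tail
  rw [← tsum_mul_left, ← tsum_mul_left, (summable_tail ha hq n).tsum_eq_zero_add,
    hs₁.tsum_eq_zero_add, add_assoc, ← ((summable_nat_add_iff 1).mpr hs₁).tsum_add hs₂]
  congr 1
  · rw [tailCoeff_zero hq, mul_assoc]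
  · refine tsum_congr fun k => ?_
    rw [tailCoeff_succ hq, partNum]
    ring

lemma exists_tendsto_tail (ha : ‖a‖ < 1) (hq : ‖q‖ < 1) :
    ∃ t, Tendsto (tail a q) atTop (𝓝 t) := by
  obtain ⟨C, hC⟩ := exists_norm_tail_le ha hq
  refine cauchySeq_tendsto_of_complete (cauchySeq_of_dist_le_of_summable _ (fun n => ?_)
    (((summable_norm_partDen_sub_one hq).add (summable_norm_partNum a hq)).mul_right C))
  calc dist (tail a q n) (tail a q (n + 1))
      = ‖(partDen q n - 1) * tail a q (n + 1) + partNum a q n * tail a q (n + 2)‖ := by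
        rw [dist_eq_norm, tail_recurrence ha hq n]
        ring_nf
    _ ≤ ‖partDen q n - 1‖ * C + ‖partNum a q n‖ * C := by
        refine norm_add_le_of_le ?_ ?_ <;> rw [norm_mul] <;> gcongr <;> exact hC _
    _ = (‖partDen q n - 1‖ + ‖partNum a q n‖) * C := (add_mul _ _ _).symm

lemma tail_zero_add_two_mul_tail_one (ha : ‖a‖ < 1) (hq : ‖q‖ < 1) :
    tail a q 0 + 2 * a * tail a q 1 = qBinomSeries (-1) q a := by
  have hs := summable_qBinomSeries (-1) hq ha
  have heven : Summable fun k => qBinomCoeff (-1) q (2 * k) * a ^ (2 * k) :=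
    hs.comp_injective (i := fun k => 2 * k) (mul_right_injective₀ two_ne_zero)
  have hodd : Summable fun k => qBinomCoeff (-1) q (2 * k + 1) * a ^ (2 * k + 1) :=
    hs.comp_injective (i := fun k => 2 * k + 1)
      ((add_left_injective 1).comp (mul_right_injective₀ two_ne_zero))
  rw [qBinomSeries, ← tsum_even_add_odd (f := fun k => qBinomCoeff (-1) q k * a ^ k) heven hodd,
    tail, tail, ← tsum_mul_left]
  simp only [qBinomCoeff_neg_one_even, qBinomCoeff_neg_one_odd]
  congr 1
  exact tsum_congr fun k => by ring

lemma tail_zero_sub_two_mul_tail_one (ha : ‖a‖ < 1) (hq : ‖q‖ < 1) :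
    tail a q 0 - 2 * a * tail a q 1 = qBinomSeries (-1) q (-a) := by
  rw [← tail_zero_add_two_mul_tail_one (norm_neg a ▸ ha) hq, tail_neg, tail_neg]
  ring

end Tail

section LambertSeries

variable {a q : ℂ}

lemma norm_inv_mul_one_sub_pow_le (hq : ‖q‖ < 1) (n : ℕ) :
    ‖((2 * (n : ℂ) + 1) * (1 - q ^ (2 * n + 1)))⁻¹‖ ≤ (1 - ‖q‖)⁻¹ := by
  have hodd : 1 ≤ ‖2 * (n : ℂ) + 1‖ := by
    rw [← Nat.cast_ofNat, ← Nat.cast_mul, ← Nat.cast_succ, Complex.norm_natCast]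
    exact Nat.one_le_cast.mpr (Nat.succ_pos _)
  have hpow : 1 - ‖q‖ ≤ ‖1 - q ^ (2 * n + 1)‖ := by
    have htri := norm_sub_norm_le 1 (q ^ (2 * n + 1))
    have hle : ‖q‖ ^ (2 * n + 1) ≤ ‖q‖ :=
      pow_le_of_le_one (norm_nonneg q) hq.le (Nat.succ_ne_zero _)
    rw [norm_one, norm_pow] at htri
    linarith
  rw [norm_inv, norm_mul]
  exact inv_anti₀ (sub_pos.mpr hq) (hpow.trans (le_mul_of_one_le_left (norm_nonneg _) hodd))

lemma term_eq_mul_pow (a q : ℂ) (n : ℕ) :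
    term a q n = ((2 * (n : ℂ) + 1) * (1 - q ^ (2 * n + 1)))⁻¹ * a ^ (2 * n + 1) :=
  div_eq_inv_mul _ _

lemma summable_term (ha : ‖a‖ < 1) (hq : ‖q‖ < 1) : Summable (term a q) := by
  simp only [funext (term_eq_mul_pow a q)]
  exact summable_mul_pow (norm_inv_mul_one_sub_pow_le hq) (fun n => by lia) ha

lemma continuousOn_tsum_term (hq : ‖q‖ < 1) :
    ContinuousOn (fun a => ∑' n, term a q n) (Metric.ball 0 1) := by
  simp only [term_eq_mul_pow]
  exact continuousOn_tsum_mul_pow (norm_inv_mul_one_sub_pow_le hq) fun n => by lia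

lemma tsum_term_zero (q : ℂ) : ∑' n, term 0 q n = 0 := by
  simp [term]

lemma tsum_term_neg (a q : ℂ) : ∑' n, term (-a) q n = -∑' n, term a q n := by
  simp only [term, (odd_two_mul_add_one _).neg_pow, neg_div, tsum_neg]

lemma hasSum_log_one_add_sub_log_one_sub {z : ℂ} (hz : ‖z‖ < 1) :
    HasSum (fun n : ℕ => 2 * (z ^ (2 * n + 1) / (2 * (n : ℂ) + 1)))
      (Complex.log (1 + z) - Complex.log (1 - z)) := by
  have hlog := (Complex.hasSum_taylorSeries_neg_log hz).sub
    (Complex.hasSum_taylorSeries_neg_log (norm_neg z ▸ hz))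
  have heven (n : ℕ) (hn : n ∉ Set.range fun k => 2 * k + 1) :
      z ^ n / (n : ℂ) - (-z) ^ n / (n : ℂ) = 0 := by
    have hn' : Even n := by
      contrapose! hn
      exact (Nat.not_even_iff_odd.mp hn).imp fun k hk => hk.symm
    rw [hn'.neg_pow, sub_self]
  have hinj : Function.Injective fun k : ℕ => 2 * k + 1 :=
    (add_left_injective 1).comp (mul_right_injective₀ two_ne_zero)
  rw [← hinj.hasSum_iff heven, neg_sub_neg, sub_neg_eq_add] at hlog
  refine hlog.congr_fun fun n => ?_
  simp only [Function.comp_apply, (odd_two_mul_add_one n).neg_pow]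
  push_cast
  ring

lemma exp_two_mul_tsum_term_dilation (ha : ‖a‖ < 1) (hq : ‖q‖ < 1) :
    Complex.exp (2 * ∑' n, term a q n) =
      (1 + a) / (1 - a) * Complex.exp (2 * ∑' n, term (q * a) q n) := by
  have hqa : ‖q * a‖ < 1 := by simpa only [pow_one] using norm_pow_mul_lt_one hq ha 1
  have hdiff : 2 * ∑' n, term a q n - 2 * ∑' n, term (q * a) q n =
      Complex.log (1 + a) - Complex.log (1 - a) := by
    rw [← mul_sub, ← (summable_term ha hq).tsum_sub (summable_term hqa hq), ← tsum_mul_left,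
      ← (hasSum_log_one_add_sub_log_one_sub ha).tsum_eq]
    refine tsum_congr fun n => ?_
    have hn : 1 - q ^ (2 * n + 1) ≠ 0 := one_sub_pow_ne_zero hq (Nat.succ_ne_zero _)
    rw [term, term, mul_pow, ← sub_div, ← one_sub_mul, mul_comm (1 - _), mul_div_mul_right _ _ hn]
  have hadd : 1 + a ≠ 0 :=
    sub_neg_eq_add 1 a ▸ one_sub_ne_zero_of_norm_lt_one (norm_neg a ▸ ha)
  rw [← sub_add_cancel (2 * _) (2 * ∑' n, term (q * a) q n), hdiff, Complex.exp_add,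
    Complex.exp_sub, Complex.exp_log hadd, Complex.exp_log (one_sub_ne_zero_of_norm_lt_one ha)]

lemma qBinomSeries_neg_one_eq_exp (ha : ‖a‖ < 1) (hq : ‖q‖ < 1) :
    qBinomSeries (-1) q a = Complex.exp (2 * ∑' n, term a q n) := by
  have hcont : ContinuousAt (fun z => Complex.exp (2 * ∑' n, term z q n)) 0 :=
    (((continuousOn_tsum_term hq).continuousAt (Metric.ball_mem_nhds 0 one_pos)).const_mul 2).cexp
  have hexp (w : ℂ) (hw : ‖w‖ < 1) : Complex.exp (2 * ∑' n, term w q n) =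
      (1 - -1 * w) / (1 - w) * Complex.exp (2 * ∑' n, term (q * w) q n) := by
    rw [neg_one_mul, sub_neg_eq_add, ← exp_two_mul_tsum_term_dilation hw hq]
  simpa only [tsum_term_zero, qBinomSeries_zero, mul_zero, Complex.exp_zero, mul_one] using
    mul_apply_zero_eq_of_dilation hq (fun w => qBinomSeries_dilation (-1) hq) hexp
      (continuousAt_qBinomSeries_zero (-1) hq) hcont ha

lemma tail_zero_eq_cosh (ha : ‖a‖ < 1) (hq : ‖q‖ < 1) :
    tail a q 0 = Complex.cosh (2 * ∑' n, term a q n) := by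
  have hadd := tail_zero_add_two_mul_tail_one ha hq
  have hsub := tail_zero_sub_two_mul_tail_one ha hq
  rw [qBinomSeries_neg_one_eq_exp ha hq] at hadd
  rw [qBinomSeries_neg_one_eq_exp (norm_neg a ▸ ha) hq, tsum_term_neg, mul_neg] at hsub
  rw [Complex.cosh]
  linear_combination (hadd + hsub) / 2

lemma two_mul_tail_one_eq_sinh (ha : ‖a‖ < 1) (hq : ‖q‖ < 1) :
    2 * a * tail a q 1 = Complex.sinh (2 * ∑' n, term a q n) := by
  rw [← add_right_inj (tail a q 0), tail_zero_add_two_mul_tail_one ha hq, tail_zero_eq_cosh ha hq,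
    Complex.cosh_add_sinh, qBinomSeries_neg_one_eq_exp ha hq]

end LambertSeries

section Projective

/-- The point of the projective line `𝕜 ∪ {∞}` with homogeneous coordinates `[x : y]`, used for
the convergents `[Aₙ : Bₙ]`. The value at `x = y = 0` is a placeholder. -/
noncomputable def ratio {𝕜 : Type*} [Field 𝕜] (x y : 𝕜) : OnePoint 𝕜 :=
  open Classical in
  if y = 0 then OnePoint.infty else ((x / y : 𝕜) : OnePoint 𝕜)

lemma ratio_zero_right {𝕜 : Type*} [Field 𝕜] (x : 𝕜) : ratio x 0 = OnePoint.infty :=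
  if_pos rfl

lemma ratio_of_ne_zero {𝕜 : Type*} [Field 𝕜] (x : 𝕜) {y : 𝕜} (hy : y ≠ 0) :
    ratio x y = ((x / y : 𝕜) : OnePoint 𝕜) :=
  if_neg hy

lemma ratio_mul_mul_right {𝕜 : Type*} [Field 𝕜] (x y : 𝕜) {t : 𝕜} (ht : t ≠ 0) :
    ratio (x * t) (y * t) = ratio x y := by
  by_cases hy : y = 0
  · rw [hy, zero_mul, ratio_zero_right, ratio_zero_right]
  · rw [ratio_of_ne_zero _ (mul_ne_zero hy ht), ratio_of_ne_zero _ hy, mul_div_mul_right _ _ ht]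

lemma ratio_ne_one {𝕜 : Type*} [Field 𝕜] {x y : 𝕜} (h : x ≠ y) :
    ratio x y ≠ ((1 : 𝕜) : OnePoint 𝕜) := by
  by_cases hy : y = 0
  · rw [hy, ratio_zero_right]
    exact OnePoint.infty_ne_coe 1
  · rwa [ratio_of_ne_zero x hy, Ne, OnePoint.coe_eq_coe, div_eq_one_iff_eq hy]

variable {ι 𝕜 : Type*} [NormedField 𝕜] [ProperSpace 𝕜] {l : Filter ι} {X Y : ι → 𝕜} {x y : 𝕜}

lemma tendsto_ratio_infty (hX : Tendsto X l (𝓝 x)) (hY : Tendsto Y l (𝓝 0)) (hx : x ≠ 0) :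
    Tendsto (fun i => ratio (X i) (Y i)) l (𝓝 OnePoint.infty) := by
  have hY' : Tendsto Y (l ⊓ 𝓟 {i | ¬Y i = 0}) (𝓝[≠] 0) :=
    tendsto_nhdsWithin_iff.mpr ⟨hY.mono_left inf_le_left,
      eventually_inf_principal.mpr (.of_forall fun _ => id)⟩
  have hnorm : Tendsto (fun i => ‖X i / Y i‖) (l ⊓ 𝓟 {i | ¬Y i = 0}) atTop := by
    simp only [div_eq_mul_inv, norm_mul]
    exact (hX.norm.mono_left inf_le_left).pos_mul_atTop (norm_pos_iff.mpr hx)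
      (tendsto_norm_cobounded_atTop.comp (tendsto_inv₀_nhdsNE_zero.comp hY'))
  classical
  refine Tendsto.if tendsto_const_nhds (OnePoint.tendsto_coe_infty.comp ?_)
  rw [coclosedCompact_eq_cocompact, ← Metric.cobounded_eq_cocompact]
  exact tendsto_norm_atTop_iff_cobounded.mp hnorm

lemma tendsto_ratio (hX : Tendsto X l (𝓝 x)) (hY : Tendsto Y l (𝓝 y)) (hxy : x ≠ 0 ∨ y ≠ 0) :
    Tendsto (fun i => ratio (X i) (Y i)) l (𝓝 (ratio x y)) := by
  by_cases hy : y = 0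
  · rw [hy, ratio_zero_right]
    exact tendsto_ratio_infty hX (hy ▸ hY) (hxy.resolve_right (not_not.mpr hy))
  · rw [ratio_of_ne_zero x hy]
    refine ((OnePoint.continuous_coe.tendsto (x / y)).comp (hX.div hY hy)).congr' ?_
    filter_upwards [hY.eventually_ne hy] with i hi using (ratio_of_ne_zero _ hi).symm

end Projective

section RiemannSphere

lemma moebius_ratio {x y : ℂ} (h : x ≠ y) : moebius (ratio x y) = (y + x) / (y - x) := by
  have hyx : y - x ≠ 0 := sub_ne_zero.mpr h.symm
  by_cases hy : y = 0
  · have hx : x ≠ 0 := hy ▸ h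
    rw [hy, ratio_zero_right, zero_add, zero_sub, div_neg, div_self hx]
    rfl
  · have : 1 - x / y ≠ 0 := by
      rw [one_sub_div hy]
      exact div_ne_zero hyx hy
    rw [ratio_of_ne_zero x hy]
    change -1 + 2 / (1 - x / y) = _
    field_simp
    ring

lemma convergent_eq_ratio (g : GenContFract ℂ) (n : ℕ) :
    convergent g n = ratio (g.nums n) (g.dens n) := by
  rw [convergent, ratio, g.conv_eq_num_div_den]

lemma sinh_ne_cosh (w : ℂ) : Complex.sinh w ≠ Complex.cosh w := by
  rw [ne_comm, ← sub_ne_zero, Complex.cosh_sub_sinh]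
  exact Complex.exp_ne_zero _

lemma moebius_ratio_sinh_cosh (w : ℂ) :
    moebius (ratio (Complex.sinh w) (Complex.cosh w)) = Complex.exp (2 * w) := by
  rw [moebius_ratio (sinh_ne_cosh w), Complex.cosh_add_sinh, Complex.cosh_sub_sinh,
    ← Complex.exp_sub, sub_neg_eq_add, two_mul]

lemma ratio_sinh_cosh_ofReal (y : ℝ) :
    ratio (Complex.sinh y) (Complex.cosh y) = ((Real.tanh y : ℂ) : OnePoint ℂ) := by
  have hcosh : Complex.cosh y ≠ 0 := by
    exact_mod_cast (Real.cosh_pos y).ne'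
  rw [ratio_of_ne_zero _ hcosh, ← Complex.tanh_eq_sinh_div_cosh, Complex.ofReal_tanh]

lemma log_neg_one_add_two_div_one_sub_tanh (y : ℝ) :
    Real.log (-1 + 2 / (1 - Real.tanh y)) = 2 * y := by
  have hlt := Real.tanh_lt_one y
  have hne : 1 - Real.tanh y ≠ 0 := (sub_pos.mpr hlt).ne'
  have hlog := Real.artanh_eq_half_log ⟨(Real.neg_one_lt_tanh y).le, hlt.le⟩
  have harg : -1 + 2 / (1 - Real.tanh y) = (1 + Real.tanh y) / (1 - Real.tanh y) := by
    field_simp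
    ring
  rw [Real.artanh_tanh] at hlog
  rw [harg]
  linarith

end RiemannSphere

section ContinuedFraction

variable {a q : ℂ}

lemma cf_get?_zero (a q : ℂ) : (cf a q).s.get? 0 = some ⟨2 * a, partDen q 0⟩ :=
  rfl

lemma cf_get?_succ (a q : ℂ) (n : ℕ) :
    (cf a q).s.get? (n + 1) = some ⟨partNum a q n, partDen q (n + 1)⟩ :=
  rfl

lemma cf_nums_recurrence (a q : ℂ) (n : ℕ) : (cf a q).nums (n + 2) =
    partDen q (n + 1) * (cf a q).nums (n + 1) + partNum a q n * (cf a q).nums n :=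
  GenContFract.nums_recurrence (cf_get?_succ a q n) rfl rfl

lemma cf_dens_recurrence (a q : ℂ) (n : ℕ) : (cf a q).dens (n + 2) =
    partDen q (n + 1) * (cf a q).dens (n + 1) + partNum a q n * (cf a q).dens n :=
  GenContFract.dens_recurrence (cf_get?_succ a q n) rfl rfl

lemma lim_nums_mul_lim_tail_eq_sinh (ha : ‖a‖ < 1) (hq : ‖q‖ < 1) {A t : ℂ}
    (hA : Tendsto (cf a q).nums atTop (𝓝 A)) (ht : Tendsto (tail a q) atTop (𝓝 t)) :
    A * t = Complex.sinh (2 * ∑' n, term a q n) := by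
  rw [mul_eq_of_recurrence_of_tendsto (cf_nums_recurrence a q) (tail_recurrence ha hq)
      (summable_norm_partNum a hq).of_norm.tendsto_atTop_zero hA ht,
    GenContFract.zeroth_num_eq_h, GenContFract.first_num_eq (cf_get?_zero a q),
    ← two_mul_tail_one_eq_sinh ha hq]
  simp only [cf, mul_zero, zero_mul, zero_add, add_zero]

lemma lim_dens_mul_lim_tail_eq_cosh (ha : ‖a‖ < 1) (hq : ‖q‖ < 1) {B t : ℂ}
    (hB : Tendsto (cf a q).dens atTop (𝓝 B)) (ht : Tendsto (tail a q) atTop (𝓝 t)) :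
    B * t = Complex.cosh (2 * ∑' n, term a q n) := by
  rw [mul_eq_of_recurrence_of_tendsto (cf_dens_recurrence a q) (tail_recurrence ha hq)
      (summable_norm_partNum a hq).of_norm.tendsto_atTop_zero hB ht,
    GenContFract.zeroth_den_eq_one, GenContFract.first_den_eq (cf_get?_zero a q), mul_one,
    ← tail_zero_eq_cosh ha hq, tail_recurrence ha hq 0]

lemma tendsto_convergent_cf (ha : ‖a‖ < 1) (hq : ‖q‖ < 1) :
    Tendsto (convergent (cf a q)) atTop (𝓝 (ratio (Complex.sinh (2 * ∑' n, term a q n))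
      (Complex.cosh (2 * ∑' n, term a q n)))) := by
  have hb := summable_norm_partDen_sub_one hq
  have hc := summable_norm_partNum a hq
  obtain ⟨A, hA⟩ := exists_tendsto_of_recurrence hb hc (cf_nums_recurrence a q)
  obtain ⟨B, hB⟩ := exists_tendsto_of_recurrence hb hc (cf_dens_recurrence a q)
  obtain ⟨t, ht⟩ := exists_tendsto_tail ha hq
  have hAt := lim_nums_mul_lim_tail_eq_sinh ha hq hA ht
  have hBt := lim_dens_mul_lim_tail_eq_cosh ha hq hB ht
  have hne : A * t ≠ B * t := by
    rw [hAt, hBt]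
    exact sinh_ne_cosh _
  have ht0 : t ≠ 0 := by
    rintro rfl
    simp at hne
  have hAB : A ≠ 0 ∨ B ≠ 0 := by
    by_contra! h
    simp [h] at hne
  rw [← hAt, ← hBt, ratio_mul_mul_right A B ht0]
  exact (tendsto_ratio hA hB hAB).congr fun n => (convergent_eq_ratio _ n).symm

lemma u_eq_ratio (ha : ‖a‖ < 1) (hq : ‖q‖ < 1) :
    u a q = ratio (Complex.sinh (2 * ∑' n, term a q n)) (Complex.cosh (2 * ∑' n, term a q n)) :=
  (tendsto_convergent_cf ha hq).limUnder_eq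

lemma tendsto_convergent_u (ha : ‖a‖ < 1) (hq : ‖q‖ < 1) :
    Tendsto (convergent (cf a q)) atTop (𝓝 (u a q)) :=
  u_eq_ratio ha hq ▸ tendsto_convergent_cf ha hq

lemma u_ne_one (ha : ‖a‖ < 1) (hq : ‖q‖ < 1) : u a q ≠ ((1 : ℂ) : OnePoint ℂ) :=
  u_eq_ratio ha hq ▸ ratio_ne_one (sinh_ne_cosh _)

lemma moebius_u (ha : ‖a‖ < 1) (hq : ‖q‖ < 1) :
    moebius (u a q) = Complex.exp (4 * ∑' n, term a q n) := by
  rw [u_eq_ratio ha hq, moebius_ratio_sinh_cosh, ← mul_assoc]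
  norm_num

lemma u_ofReal {a q : ℝ} (ha : |a| < 1) (hq : |q| < 1) :
    u (a : ℂ) (q : ℂ) = ((Real.tanh (2 * ∑' n : ℕ,
      a ^ (2 * n + 1) / ((2 * (n : ℝ) + 1) * (1 - q ^ (2 * n + 1)))) : ℂ) : OnePoint ℂ) := by
  rw [← Real.norm_eq_abs, ← Complex.norm_real] at ha hq
  rw [u_eq_ratio ha hq, ← ratio_sinh_cosh_ofReal]
  push_cast
  rfl

end ContinuedFraction

section LogBranch

lemma isLogBranch_tsum_term {q : ℂ} (hq : ‖q‖ < 1) :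
    IsLogBranch (fun a => 4 * ∑' n, term a q n) (fun a => moebius (u a q)) :=
  ⟨continuousOn_const.mul (continuousOn_tsum_term hq), by simp only [tsum_term_zero, mul_zero],
    fun _ ha => (moebius_u (mem_ball_zero_iff.mp ha) hq).symm⟩

lemma IsLogBranch.eqOn {ℓ₁ ℓ₂ F : ℂ → ℂ} (h₁ : IsLogBranch ℓ₁ F) (h₂ : IsLogBranch ℓ₂ F) :
    Set.EqOn ℓ₁ ℓ₂ (Metric.ball 0 1) :=
  Complex.isCoveringMap_exp.eqOn_of_comp_eqOn (convex_ball 0 1).isPreconnected h₁.1 h₂.1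
    (fun a ha => Subtype.ext ((h₁.2.2 a ha).trans (h₂.2.2 a ha).symm))
    (Metric.mem_ball_self one_pos) (h₁.2.1.trans h₂.2.1.symm)

end LogBranch

end RamanujanCF

theorem proposition7 :
    -- convergence of both sides; the quotient `2 / (1 - u(a, q))` is meaningful
    (∀ a q : ℂ, ‖a‖ < 1 → ‖q‖ < 1 →
      Summable (RamanujanCF.term a q) ∧
      Tendsto (RamanujanCF.convergent (RamanujanCF.cf a q)) atTop (𝓝 (RamanujanCF.u a q)) ∧
      RamanujanCF.u a q ≠ ((1 : ℂ) : OnePoint ℂ)) ∧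
    -- the series is the branch of the logarithm on the unit disc that vanishes at `a = 0`
    (∀ q : ℂ, ‖q‖ < 1 →
      RamanujanCF.IsLogBranch (fun a => 4 * ∑' n : ℕ, RamanujanCF.term a q n)
        (fun a => RamanujanCF.moebius (RamanujanCF.u a q)) ∧
      ∀ ℓ : ℂ → ℂ,
        RamanujanCF.IsLogBranch ℓ (fun a => RamanujanCF.moebius (RamanujanCF.u a q)) →
        ∀ a : ℂ, ‖a‖ < 1 → 4 * ∑' n : ℕ, RamanujanCF.term a q n = ℓ a) ∧
    -- it is the principal value whenever its imaginary part allows this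
    (∀ a q : ℂ, ‖a‖ < 1 → ‖q‖ < 1 →
      (4 * ∑' n : ℕ, RamanujanCF.term a q n).im ∈ Set.Ioc (-Real.pi) Real.pi →
      4 * ∑' n : ℕ, RamanujanCF.term a q n =
        Complex.log (RamanujanCF.moebius (RamanujanCF.u a q))) ∧
    -- for real parameters it is the real logarithm
    (∀ a q : ℝ, |a| < 1 → |q| < 1 →
      ∃ x : ℝ, RamanujanCF.u (a : ℂ) (q : ℂ) = (((x : ℝ) : ℂ) : OnePoint ℂ) ∧ |x| < 1 ∧
        4 * ∑' n : ℕ, a ^ (2 * n + 1) / ((2 * (n : ℝ) + 1) * (1 - q ^ (2 * n + 1))) =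
          Real.log (-1 + 2 / (1 - x))) := by
  open RamanujanCF in
  refine ⟨fun a q ha hq => ⟨summable_term ha hq, tendsto_convergent_u ha hq, u_ne_one ha hq⟩,
    fun q hq => ⟨isLogBranch_tsum_term hq, fun ℓ hℓ a ha =>
      (isLogBranch_tsum_term hq).eqOn hℓ (mem_ball_zero_iff.mpr ha)⟩,
    fun a q ha hq him => by rw [moebius_u ha hq, Complex.log_exp him.1 him.2],
    fun a q ha hq => ⟨_, u_ofReal ha hq, ?_, ?_⟩⟩
  · exact abs_lt.mpr ⟨Real.neg_one_lt_tanh _, Real.tanh_lt_one _⟩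
  · rw [RamanujanCF.log_neg_one_add_two_div_one_sub_tanh]
    ring
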